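/- **Theorem 3.** An online MDP with known dynamics and aggregate bandit feedback is the following game. There are a finite state space of size $S$, a finite action space of size $A$, a horizon $H$, a number $K$ of episodes, transition functions $p_h(\cdot\mid s,a)$ ($h\in[H]$) and an initial state $s_{init}$, all known to the learner, and cost functions $\ell^1,\dots,\ell^K$ with $\ell^k_h(s,a)\in[0,1]$, fixed in advance by an oblivious adversary and unknown to the learner. In episode $k$ the learner picks a Markov policy $\pi^k=(\pi^k_h(\cdot\mid s))_{h,s}$, possibly at random, on the basis of its earlier observations. The trajectory $s_1^k=s_{init}$, $a_h^k\sim\pi_h^k(\cdot\mid s_h^k)$, $s_{h+1}^k\sim p_h(\cdot\mid s_h^k,a_h^k)$ is generated, and the learner observes this trajectory and only the aggregate loss $\sum_{h=1}^H\ell^k_h(s_h^k,a_h^k)$. Let $V_1^{\pi}(s_{init};\ell)$ be the expected total cost of one episode under the policy $\pi$ and the cost function $\ell$. The regret is $$R_K=\sum_{k=1}^K V_1^{\pi^k}(s_{init};\ell^k)-\min_{\pi}\sum_{k=1}^K V_1^{\pi}(s_{init};\ell^k),$$ where the minimum is over all Markov policies. There is a universal constant $c>0$ such that, for all $H,S,A\ge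 2$ and $K\ge 2S$ and for every (possibly randomized) learning algorithm, there are dynamics $p$, an initial state and costs $\ell^1,\dots,\ell^K$ for which $$\mathbb E[R_K]\ \ge\ c\,\min\bigl\{H^2\sqrt{SAK},\;HK\bigr\}.$$ In particular the worst-case expected regret is $\Omega(H^2\sqrt{SAK})$ as soon as $K\ge H^2SA$. -/

import Mathlib

open MeasureTheory
open scoped BigOperators

universe u

noncomputable section

/-- A (time-dependent) transition function: `p h s a s'` is the probability of moving from `s`
to `s'` when action `a` is taken in step `h`. Steps are numbered `0, …, H - 1`. -/
abbrev Dynamics (𝒮 𝒜 : Type) [Fintype 𝒮] (H : ℕ) : Type :=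
  Fin H → 𝒮 → 𝒜 → stdSimplex ℝ 𝒮

/-- A (randomized, Markov, time-dependent) policy: `π h s a` is the probability of taking
action `a` in state `s` in step `h`. -/
abbrev Policy (𝒮 𝒜 : Type) [Fintype 𝒜] (H : ℕ) : Type :=
  Fin H → 𝒮 → stdSimplex ℝ 𝒜

/-- A cost function of one episode, with values in `[0,1]`. -/
abbrev Cost (𝒮 𝒜 : Type) (H : ℕ) : Type :=
  Fin H → 𝒮 → 𝒜 → Set.Icc (0 : ℝ) 1

/-- The state-action pairs visited in the `H` steps of an episode. -/
abbrev Trajectory (𝒮 𝒜 : Type) (H : ℕ) : Type :=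
  Fin H → 𝒮 × 𝒜

/-- The aggregate loss of an episode: the sum of all costs along its trajectory. -/
def totalCost {𝒮 𝒜 : Type} {H : ℕ} (l : Cost 𝒮 𝒜 H) (τ : Trajectory 𝒮 𝒜 H) : ℝ :=
  ∑ h, (l h (τ h).1 (τ h).2 : ℝ)

/-- The conditional probability, given the trajectory before step `h`, that the state in step `h`
is the one in `τ`: the first state is `s₀`, and the later ones follow the transition function. -/
def arrivalProb {𝒮 𝒜 : Type} [Fintype 𝒮] [DecidableEq 𝒮] {H : ℕ} (p : Dynamics 𝒮 𝒜 H)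
    (s₀ : 𝒮) (τ : Trajectory 𝒮 𝒜 H) : Fin H → ℝ
  | ⟨0, h0⟩ => if (τ ⟨0, h0⟩).1 = s₀ then 1 else 0
  | ⟨n + 1, hn⟩ =>
      (p ⟨n, Nat.lt_of_succ_lt hn⟩ (τ ⟨n, Nat.lt_of_succ_lt hn⟩).1
        (τ ⟨n, Nat.lt_of_succ_lt hn⟩).2).1 (τ ⟨n + 1, hn⟩).1

/-- The probability of the trajectory `τ` when policy `π` is run for one episode from `s₀`. -/
def trajectoryProb {𝒮 𝒜 : Type} [Fintype 𝒮] [DecidableEq 𝒮] [Fintype 𝒜] {H : ℕ}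
    (p : Dynamics 𝒮 𝒜 H) (s₀ : 𝒮) (π : Policy 𝒮 𝒜 H) (τ : Trajectory 𝒮 𝒜 H) : ℝ :=
  ∏ h, arrivalProb p s₀ τ h * (π h (τ h).1).1 (τ h).2

/-- The value of `π` from the initial state: the expected cost of an episode. -/
def value {𝒮 𝒜 : Type} [Fintype 𝒮] [DecidableEq 𝒮] [Fintype 𝒜] {H : ℕ}
    (p : Dynamics 𝒮 𝒜 H) (s₀ : 𝒮) (π : Policy 𝒮 𝒜 H) (l : Cost 𝒮 𝒜 H) : ℝ :=
  ∑ τ, trajectoryProb p s₀ π τ * totalCost l τ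

/-- A randomized learner for `K` episodes with aggregate bandit feedback. Its random bits are a
sample from a probability space. The policy of episode `k` is a function of the random bits and of
what was observed in the earlier episodes: the trajectory and the aggregate loss of each. -/
structure Learner (𝒮 𝒜 : Type) [Fintype 𝒜] (H K : ℕ) where
  Seed : Type u
  [measurableSpace : MeasurableSpace Seed]
  law : Measure Seed
  [isProbabilityMeasure : IsProbabilityMeasure law]
  policy : (k : Fin K) → Seed → (Fin k → Trajectory 𝒮 𝒜 H × ℝ) → Policy 𝒮 𝒜 H
  measurable_policy : ∀ k past, Measurable fun ω => policy k ω past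

attribute [instance] Learner.measurableSpace Learner.isProbabilityMeasure

/-- What the learner has observed before episode `k`, if `τ` lists the trajectories of all
episodes and `l` their cost functions. -/
def feedback {𝒮 𝒜 : Type} {H K : ℕ} (l : Fin K → Cost 𝒮 𝒜 H)
    (τ : Fin K → Trajectory 𝒮 𝒜 H) (k : Fin K) : Fin k → Trajectory 𝒮 𝒜 H × ℝ :=
  fun j => (τ (Fin.castLE k.isLt.le j),
    totalCost (l (Fin.castLE k.isLt.le j)) (τ (Fin.castLE k.isLt.le j)))

/-- The policy that the learner plays in episode `k`, given its random bits `ω` and the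
trajectories `τ` (of which only those before episode `k` matter). -/
def Learner.played {𝒮 𝒜 : Type} [Fintype 𝒜] {H K : ℕ} (L : Learner.{u} 𝒮 𝒜 H K)
    (l : Fin K → Cost 𝒮 𝒜 H) (ω : L.Seed) (τ : Fin K → Trajectory 𝒮 𝒜 H) (k : Fin K) :
    Policy 𝒮 𝒜 H :=
  L.policy k ω (feedback l τ k)

/-- The probability, given the learner's random bits `ω`, that the trajectories of the `K`
episodes are `τ`. -/
def interactionProb {𝒮 𝒜 : Type} [Fintype 𝒮] [DecidableEq 𝒮] [Fintype 𝒜] {H K : ℕ}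
    (L : Learner.{u} 𝒮 𝒜 H K) (p : Dynamics 𝒮 𝒜 H) (s₀ : 𝒮) (l : Fin K → Cost 𝒮 𝒜 H)
    (ω : L.Seed) (τ : Fin K → Trajectory 𝒮 𝒜 H) : ℝ :=
  ∏ k, trajectoryProb p s₀ (L.played l ω τ k) (τ k)

/-- The regret of a sequence of policies against the best fixed policy in hindsight. -/
def regret {𝒮 𝒜 : Type} [Fintype 𝒮] [DecidableEq 𝒮] [Fintype 𝒜] {H K : ℕ}
    (p : Dynamics 𝒮 𝒜 H) (s₀ : 𝒮) (l : Fin K → Cost 𝒮 𝒜 H) (π : Fin K → Policy 𝒮 𝒜 H) : ℝ :=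
  ∑ k, value p s₀ (π k) (l k) - ⨅ ρ : Policy 𝒮 𝒜 H, ∑ k, value p s₀ ρ (l k)

/-- The expected regret of a learner, over its own random bits and over the trajectories. -/
def expectedRegret {𝒮 𝒜 : Type} [Fintype 𝒮] [DecidableEq 𝒮] [Fintype 𝒜] {H K : ℕ}
    (L : Learner.{u} 𝒮 𝒜 H K) (p : Dynamics 𝒮 𝒜 H) (s₀ : 𝒮) (l : Fin K → Cost 𝒮 𝒜 H) : ℝ :=
  ∫ ω, ∑ τ : Fin K → Trajectory 𝒮 𝒜 H,
    interactionProb L p s₀ l ω τ * regret p s₀ l (L.played l ω τ) ∂L.law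

end

/-!
The hard instances have dynamics that ignore the actions: every state after the first is uniform.
So each pair of a step `h ≠ 0` and a state `s` is an `A`-armed bandit, visited in about `K / S`
episodes. Prescribe an action `a (h, s)` in each of them, with bonus `ε = H / (4 * M)`. All costs of
episode `k` are `1 / 2 + g k / (4 * M)`, minus `ε` on the prescribed pairs, where `g k` is an integer
noise with values in `[-M, M]`. The noise is common to all pairs of an episode. Hence it cancels in
the regret, which is at least `ε` times the expected number of deviations from the prescribed
actions, but it adds up along a trajectory: the aggregate loss is `H / 2 + ε (g k - N)`, where `N` is
the number of visits to prescribed pairs, and the learner sees `N` through noise of magnitude `M`.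

To bound what the learner can find out about `a (h, s)`, compare the law of its observations with
the law when the bonus at `(h, s)` is removed. In each episode in which the bonus pair is visited,
they differ by a unit shift of the noise. The density of the noise is the square of a tent, so this
shift has triangular discrimination at most `24 / M ^ 2` (`leCam_tentLaw_shift_le`).
The discrimination obeys a chain rule in which only expectations under the reference law occur
(`half_sub_le_harmonic_pathProb`). Unlike the one for relative entropy, it needs no common support,
so the noise can be bounded. Under the reference law the expected numbers of visits to the
`A` pairs at `(h, s)` add up to `K / S`. Hence, for `M ^ 2 ≥ 3072 * K / (S * A)` and `a (h, s)` drawn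
uniformly, the learner plays `a (h, s)` with probability at most `3 / 4`
(`sum_obsLaw_insert_mul_policy_le`), and the average regret is at least `ε K (H - 1) / 4`.

The costs lie in `[0, 1]` when `H ≤ M`. Taking `M` of order `max H √(K / (S * A))` makes
`ε K (H - 1)` of order `min (H ^ 2 * √(S * A * K)) (H * K)`. The argument is carried out for each
value of the seed and then integrated, and some pair of prescribed actions and noise values does at
least as well as the average.
-/

set_option linter.unusedSectionVars false

/-! ### Laws of sequentially generated observations -/

/-- The probability of the sequence `o` of observations when `κ k past` is the conditional law of
observation `k`, given the earlier observations `past`. -/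
def pathProb {O : Type*} {K : ℕ} (κ : (k : Fin K) → (Fin k → O) → O → ℝ) (o : Fin K → O) : ℝ :=
  ∏ k, κ k (fun j => o (Fin.castLE k.isLt.le j)) (o k)

lemma pathProb_nonneg {O : Type*} {K : ℕ} {κ : (k : Fin K) → (Fin k → O) → O → ℝ}
    (hκ : ∀ k past x, 0 ≤ κ k past x) (o : Fin K → O) : 0 ≤ pathProb κ o :=
  Finset.prod_nonneg fun _ _ => hκ _ _ _

lemma pathProb_snoc {O : Type*} {K : ℕ} (κ : (k : Fin (K + 1)) → (Fin k → O) → O → ℝ)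
    (o : Fin K → O) (x : O) :
    pathProb κ (Fin.snoc o x) =
      pathProb (fun k : Fin K => κ k.castSucc) o * κ (Fin.last K) o x := by
  unfold pathProb
  rw [Fin.prod_univ_castSucc]
  congr 1
  · refine Finset.prod_congr rfl fun k _ => ?_
    rw [Fin.snoc_castSucc]
    congr 1
    funext j
    exact Fin.snoc_castSucc (α := fun _ => O) x o (Fin.castLE k.isLt.le j)
  · rw [Fin.snoc_last]
    congr 1
    funext j
    exact Fin.snoc_castSucc (α := fun _ => O) x o j

lemma sum_snoc {O : Type*} [Fintype O] {K : ℕ} (F : (Fin (K + 1) → O) → ℝ) :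
    ∑ o, F o = ∑ o : Fin K → O, ∑ x : O, F (Fin.snoc o x) := by
  rw [← Fintype.sum_equiv (Fin.snocEquiv fun _ : Fin (K + 1) => O)
    (fun y => F (Fin.snoc y.2 y.1)) F fun y => rfl, Fintype.sum_prod_type, Finset.sum_comm]

lemma sum_pathProb {O : Type*} [Fintype O] {K : ℕ} {κ : (k : Fin K) → (Fin k → O) → O → ℝ}
    (hκ : ∀ k past, ∑ x, κ k past x = 1) : ∑ o, pathProb κ o = 1 := by
  induction K with
  | zero => simp [pathProb]
  | succ K ih =>
    rw [sum_snoc]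
    simp only [pathProb_snoc, ← Finset.mul_sum]
    rw [← ih (κ := fun k : Fin K => κ k.castSucc) fun k past => hκ k.castSucc past]
    exact Finset.sum_congr rfl fun o _ => by rw [hκ (Fin.last K) o, mul_one]

/-! ### A chain rule for the triangular discrimination -/

/-- The triangular discrimination (Le Cam divergence) `∑ (u - v)² / (u + v)`. A term with
`u x = v x = 0` is `0`, by the convention for division by zero. -/
noncomputable def leCam {O : Type*} [Fintype O] (u v : O → ℝ) : ℝ :=
  ∑ x, (u x - v x) ^ 2 / (u x + v x)

/-- The tangent of the concave, positively homogeneous function `(u, v) ↦ Pu Qv / (Pu + Qv)` at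
the diagonal `u = v`, with an error term that carries only the weight `P`. -/
lemma tangent_sub_le_harmonic {P Q u v : ℝ} (hP : 0 ≤ P) (hQ : 0 ≤ Q) (hu : 0 ≤ u) (hv : 0 ≤ v) :
    P * Q ^ 2 / (P + Q) ^ 2 * u + P ^ 2 * Q / (P + Q) ^ 2 * v - P * ((u - v) ^ 2 / (u + v)) ≤
      P * u * (Q * v) / (P * u + Q * v) := by
  rcases hP.eq_or_lt with rfl | hP
  · simp
  rcases hu.eq_or_lt with rfl | hu
  · rcases hv.eq_or_lt with rfl | hv
    · simp
    · have h1 : P ^ 2 * Q / (P + Q) ^ 2 ≤ P := by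
        rw [div_le_iff₀ (by positivity)]
        nlinarith [mul_nonneg hP.le hQ, mul_nonneg hP.le (sq_nonneg Q),
          mul_nonneg hP.le (sq_nonneg P), mul_nonneg (sq_nonneg P) hQ]
      have h2 : (0 - v) ^ 2 / (0 + v) = v := by field_simp; ring
      rw [h2]
      have := mul_le_mul_of_nonneg_right h1 hv.le
      simp only [mul_zero, zero_mul, zero_add, zero_div]
      linarith
  have hPu : 0 < P * u := mul_pos hP hu
  have hQv : 0 ≤ Q * v := mul_nonneg hQ hv
  have key : P * Q ^ 2 / (P + Q) ^ 2 * u + P ^ 2 * Q / (P + Q) ^ 2 * v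
      - P * u * (Q * v) / (P * u + Q * v)
      = P * ((u - v) ^ 2 * (P * Q ^ 2 / ((P + Q) ^ 2 * (P * u + Q * v)))) := by
    have h3 : P * u + Q * v ≠ 0 := by positivity
    have h4 : P + Q ≠ 0 := by positivity
    field_simp
    ring
  have hle : P * Q ^ 2 / ((P + Q) ^ 2 * (P * u + Q * v)) ≤ 1 / (u + v) := by
    rw [div_le_div_iff₀ (by positivity) (by positivity)]
    have e : 1 * ((P + Q) ^ 2 * (P * u + Q * v)) - P * Q ^ 2 * (u + v)
        = P * u * (P ^ 2 + 2 * P * Q) + Q * v * (P ^ 2 + P * Q + Q ^ 2) := by ring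
    have : 0 ≤ P * u * (P ^ 2 + 2 * P * Q) + Q * v * (P ^ 2 + P * Q + Q ^ 2) := by positivity
    linarith
  have := mul_le_mul_of_nonneg_left (mul_le_mul_of_nonneg_left hle (sq_nonneg (u - v))) hP.le
  rw [mul_one_div] at this
  linarith

lemma harmonic_step {O : Type*} [Fintype O] {P Q : ℝ} {u v : O → ℝ} (hP : 0 ≤ P) (hQ : 0 ≤ Q)
    (hu : ∀ x, 0 ≤ u x) (hv : ∀ x, 0 ≤ v x) (hu1 : ∑ x, u x = 1) (hv1 : ∑ x, v x = 1) :
    P * Q / (P + Q) - P * leCam u v ≤ ∑ x, P * u x * (Q * v x) / (P * u x + Q * v x) := by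
  have h := Finset.sum_le_sum fun x (_ : x ∈ Finset.univ) =>
    tangent_sub_le_harmonic hP hQ (hu x) (hv x)
  rw [Finset.sum_sub_distrib, Finset.sum_add_distrib, ← Finset.mul_sum, ← Finset.mul_sum,
    ← Finset.mul_sum, hu1, hv1] at h
  refine le_trans (le_of_eq ?_) h
  unfold leCam
  by_cases hPQ : P + Q = 0
  · have : P = 0 := by linarith
    simp [this]
  · field_simp
    ring

/-- The chain rule. The divergences of the conditional laws enter through their expectation under
the first law only. -/
lemma half_sub_le_harmonic_pathProb {O : Type*} [Fintype O] {K : ℕ}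
    {κ κ' : (k : Fin K) → (Fin k → O) → O → ℝ}
    (hκ : ∀ k past x, 0 ≤ κ k past x) (hκ' : ∀ k past x, 0 ≤ κ' k past x)
    (hκ1 : ∀ k past, ∑ x, κ k past x = 1) (hκ1' : ∀ k past, ∑ x, κ' k past x = 1) :
    1 / 2 - ∑ o, pathProb κ o *
        ∑ k, leCam (κ k fun j => o (Fin.castLE k.isLt.le j))
          (κ' k fun j => o (Fin.castLE k.isLt.le j)) ≤
      ∑ o, pathProb κ o * pathProb κ' o / (pathProb κ o + pathProb κ' o) := by
  induction K with
  | zero => simp [pathProb]; norm_num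
  | succ K ih =>
    have ih' := ih (κ := fun k : Fin K => κ k.castSucc) (κ' := fun k : Fin K => κ' k.castSucc)
      (fun k past x => hκ k.castSucc past x) (fun k past x => hκ' k.castSucc past x)
      (fun k past => hκ1 k.castSucc past) (fun k past => hκ1' k.castSucc past)
    have hL : ∑ o, pathProb κ o *
        ∑ k, leCam (κ k fun j => o (Fin.castLE k.isLt.le j))
          (κ' k fun j => o (Fin.castLE k.isLt.le j)) =
        ∑ o : Fin K → O, (pathProb (fun k : Fin K => κ k.castSucc) o *
          ∑ k : Fin K, leCam (κ k.castSucc fun j => o (Fin.castLE k.isLt.le j))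
            (κ' k.castSucc fun j => o (Fin.castLE k.isLt.le j)) +
          pathProb (fun k : Fin K => κ k.castSucc) o *
            leCam (κ (Fin.last K) o) (κ' (Fin.last K) o)) := by
      rw [sum_snoc]
      refine Finset.sum_congr rfl fun o _ => ?_
      have hx : ∀ x : O, ∑ k : Fin (K + 1),
          leCam (κ k fun j => (Fin.snoc o x : Fin (K + 1) → O) (Fin.castLE k.isLt.le j))
            (κ' k fun j => (Fin.snoc o x : Fin (K + 1) → O) (Fin.castLE k.isLt.le j)) =
          ∑ k : Fin K, leCam (κ k.castSucc fun j => o (Fin.castLE k.isLt.le j))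
            (κ' k.castSucc fun j => o (Fin.castLE k.isLt.le j)) +
            leCam (κ (Fin.last K) o) (κ' (Fin.last K) o) := by
        intro x
        rw [Fin.sum_univ_castSucc]
        congr 1
        · refine Finset.sum_congr rfl fun k _ => ?_
          have : (fun j : Fin k.castSucc => (Fin.snoc o x : Fin (K + 1) → O)
              (Fin.castLE k.castSucc.isLt.le j)) = fun j => o (Fin.castLE k.isLt.le j) := by
            funext j
            exact Fin.snoc_castSucc (α := fun _ => O) x o (Fin.castLE k.isLt.le j)
          rw [this]
          rfl
        · have : (fun j : Fin (Fin.last K) => (Fin.snoc o x : Fin (K + 1) → O)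
              (Fin.castLE (Fin.last K).isLt.le j)) = o := by
            funext j
            exact Fin.snoc_castSucc (α := fun _ => O) x o j
          rw [this]
      simp only [hx, pathProb_snoc]
      rw [← Finset.sum_mul, ← Finset.mul_sum, hκ1 (Fin.last K) o, mul_one, mul_add]
    rw [hL, Finset.sum_add_distrib, sum_snoc]
    have hstep := Finset.sum_le_sum fun o (_ : o ∈ (Finset.univ : Finset (Fin K → O))) =>
      harmonic_step (u := κ (Fin.last K) o) (v := κ' (Fin.last K) o)
        (pathProb_nonneg (κ := fun k : Fin K => κ k.castSucc)
          (fun k past x => hκ k.castSucc past x) o)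
        (pathProb_nonneg (κ := fun k : Fin K => κ' k.castSucc)
          (fun k past x => hκ' k.castSucc past x) o)
        (hκ (Fin.last K) o) (hκ' (Fin.last K) o) (hκ1 (Fin.last K) o)
        (hκ1' (Fin.last K) o)
    rw [Finset.sum_sub_distrib] at hstep
    simp only [pathProb_snoc]
    exact (sub_sub _ _ _).symm.le.trans ((sub_le_sub_right ih' _).trans hstep)

/-- A change of measure. The inequality `|x| ≤ s / 16 + 4 x² / s` keeps the bound linear in the
divergence, so that it can be averaged without Jensen's inequality. -/
lemma sum_pathProb_mul_le {O : Type*} [Fintype O] {K : ℕ}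
    {κ κ' : (k : Fin K) → (Fin k → O) → O → ℝ}
    (hκ : ∀ k past x, 0 ≤ κ k past x) (hκ' : ∀ k past x, 0 ≤ κ' k past x)
    (hκ1 : ∀ k past, ∑ x, κ k past x = 1) (hκ1' : ∀ k past, ∑ x, κ' k past x = 1)
    {f : (Fin K → O) → ℝ} (hf0 : ∀ o, 0 ≤ f o) (hf1 : ∀ o, f o ≤ 1) :
    ∑ o, pathProb κ' o * f o ≤ ∑ o, pathProb κ o * f o + 1 / 8 +
      16 * ∑ o, pathProb κ o * ∑ k, leCam (κ k fun j => o (Fin.castLE k.isLt.le j))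
          (κ' k fun j => o (Fin.castLE k.isLt.le j)) := by
  have hchain := half_sub_le_harmonic_pathProb hκ hκ' hκ1 hκ1'
  have hpt : ∀ o, pathProb κ' o * f o ≤ pathProb κ o * f o + 65 / 16 * pathProb κ o +
      65 / 16 * pathProb κ' o
        - 16 * (pathProb κ o * pathProb κ' o / (pathProb κ o + pathProb κ' o)) := by
    intro o
    have hP := pathProb_nonneg hκ o
    have hQ := pathProb_nonneg hκ' o
    have h0 := hf0 o
    have h1 := hf1 o
    generalize pathProb κ o = P at *
    generalize pathProb κ' o = Q at *
    generalize f o = y at *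
    rcases (add_nonneg hP hQ).eq_or_lt with h | h
    · have : P = 0 := by linarith
      have : Q = 0 := by linarith
      subst_vars
      simp
    · have e : 65 / 16 * P + 65 / 16 * Q - 16 * (P * Q / (P + Q)) =
          (P + Q) / 16 + 4 * ((Q - P) ^ 2 / (P + Q)) := by
        field_simp
        ring
      have habs : |Q - P| ≤ (P + Q) / 16 + 4 * ((Q - P) ^ 2 / (P + Q)) := by
        have : (P + Q) / 16 + 4 * ((Q - P) ^ 2 / (P + Q)) - |Q - P| =
            ((P + Q) - 8 * |Q - P|) ^ 2 / (16 * (P + Q)) := by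
          rw [← sq_abs (Q - P)]
          field_simp
          ring
        have : 0 ≤ ((P + Q) - 8 * |Q - P|) ^ 2 / (16 * (P + Q)) := by positivity
        linarith
      have hfy : (Q - P) * y ≤ |Q - P| :=
        calc (Q - P) * y ≤ |Q - P| * y := mul_le_mul_of_nonneg_right (le_abs_self _) h0
          _ ≤ |Q - P| * 1 := mul_le_mul_of_nonneg_left h1 (abs_nonneg _)
          _ = |Q - P| := mul_one _
      linarith
  have hsum := Finset.sum_le_sum fun o (_ : o ∈ Finset.univ) => hpt o
  rw [Finset.sum_sub_distrib, Finset.sum_add_distrib, Finset.sum_add_distrib, ← Finset.mul_sum,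
    ← Finset.mul_sum, ← Finset.mul_sum, sum_pathProb hκ1, sum_pathProb hκ1'] at hsum
  linarith

/-! ### Tent-shaped noise -/

/-- The tent of height and half-width `M`. -/
noncomputable def tent (M : ℕ) (y : ℤ) : ℝ := max 0 ((M : ℝ) - |(y : ℝ)|)

lemma tent_nonneg (M : ℕ) (y : ℤ) : 0 ≤ tent M y := le_max_left _ _

lemma tent_eq_zero {M : ℕ} {y : ℤ} (h : (M : ℤ) ≤ |y|) : tent M y = 0 := by
  have : (M : ℝ) ≤ |(y : ℝ)| := by exact_mod_cast h
  exact max_eq_left (by linarith)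

lemma abs_tent_sub_tent_succ_le (M : ℕ) (y : ℤ) : |tent M y - tent M (y + 1)| ≤ 1 := by
  have h := abs_abs_sub_abs_le_abs_sub ((y : ℝ) + 1) y
  rw [add_sub_cancel_left, abs_one] at h
  unfold tent
  push_cast
  refine (abs_max_sub_max_le_max _ _ _ _).trans ?_
  rw [sub_self, abs_zero, sub_sub_sub_cancel_left]
  exact max_le zero_le_one h

/-- The total mass of the squared tent. -/
noncomputable def tentMass (M : ℕ) : ℝ := ∑ y ∈ Finset.Icc (-(M : ℤ)) M, tent M y ^ 2

lemma pow_three_le_tentMass (M : ℕ) : (M : ℝ) ^ 3 / 3 ≤ tentMass M := by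
  have h1 : (M : ℝ) ^ 3 / 3 ≤ ∑ i ∈ Finset.range M, ((i : ℝ) + 1) ^ 2 := by
    induction M with
    | zero => simp
    | succ n ih =>
      rw [Finset.sum_range_succ]
      push_cast
      nlinarith [(Nat.cast_nonneg n : (0 : ℝ) ≤ n)]
  refine h1.trans ?_
  have hinj : Function.Injective fun i : ℕ => (M : ℤ) - 1 - i := fun i j h => by
    simp only at h; omega
  calc ∑ i ∈ Finset.range M, ((i : ℝ) + 1) ^ 2
      = ∑ i ∈ Finset.range M, tent M ((M : ℤ) - 1 - i) ^ 2 := by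
        refine Finset.sum_congr rfl fun i hi => ?_
        have hi : (i : ℝ) + 1 ≤ M := by exact_mod_cast Finset.mem_range.1 hi
        unfold tent
        push_cast
        rw [abs_of_nonneg (by linarith), max_eq_right (by linarith [(Nat.cast_nonneg i : (0:ℝ) ≤ i)])]
        ring
    _ = ∑ y ∈ (Finset.range M).map ⟨_, hinj⟩, tent M y ^ 2 := by rw [Finset.sum_map]; rfl
    _ ≤ tentMass M := by
        refine Finset.sum_le_sum_of_subset_of_nonneg ?_ fun _ _ _ => sq_nonneg _
        intro y hy
        obtain ⟨i, hi, rfl⟩ := Finset.mem_map.1 hy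
        have := Finset.mem_range.1 hi
        simp only [Function.Embedding.coeFn_mk, Finset.mem_Icc]
        omega

/-- The law of the noise: the normalised square of a tent. Squaring the tent makes the square root
of the density Lipschitz, so that a unit shift has divergence of order `1 / M ^ 2`. -/
noncomputable def tentLaw (M : ℕ) (y : ℤ) : ℝ := tent M y ^ 2 / tentMass M

lemma tentMass_pos {M : ℕ} (hM : 0 < M) : 0 < tentMass M :=
  lt_of_lt_of_le (by positivity) (pow_three_le_tentMass M)

lemma tentLaw_nonneg (M : ℕ) (y : ℤ) : 0 ≤ tentLaw M y :=
  div_nonneg (sq_nonneg _) (Finset.sum_nonneg fun _ _ => sq_nonneg _)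

lemma tentLaw_eq_zero {M : ℕ} {y : ℤ} (h : (M : ℤ) ≤ |y|) : tentLaw M y = 0 := by
  simp [tentLaw, tent_eq_zero h]

/-- The values of noise minus the number of visits to bonus pairs, where at most `H` visits are
possible. -/
abbrev Signal (M H : ℕ) : Type := Finset.Icc (-((M : ℤ) + H)) M

lemma sum_tentLaw_add {M H n : ℕ} (hM : 0 < M) (hn : n ≤ H) :
    ∑ y : Signal M H, tentLaw M ((y : ℤ) + n) = 1 := by
  have h : ∑ y ∈ Finset.Icc (-((M : ℤ) + H)) M, tentLaw M (y + n) =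
      ∑ y ∈ Finset.Icc (-(M : ℤ)) M, tentLaw M y := by
    rw [← tsum_eq_sum (L := SummationFilter.unconditional ℤ) (f := fun y : ℤ => tentLaw M (y + n)),
      ← tsum_eq_sum (L := SummationFilter.unconditional ℤ) (f := fun y : ℤ => tentLaw M y)]
    · exact (Equiv.addRight (n : ℤ)).tsum_eq (tentLaw M)
    · intro y hy
      refine tentLaw_eq_zero ?_
      rw [Finset.mem_Icc] at hy
      rw [le_abs]
      omega
    · intro y hy
      refine tentLaw_eq_zero ?_
      rw [Finset.mem_Icc] at hy
      rw [le_abs]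
      omega
  rw [Finset.sum_coe_sort (Finset.Icc (-((M : ℤ) + H)) M) fun y => tentLaw M (y + n), h]
  unfold tentLaw
  rw [← Finset.sum_div]
  exact div_self (tentMass_pos hM).ne'

lemma tentLaw_shift_le {M : ℕ} (hM : 0 < M) (y : ℤ) :
    (tentLaw M y - tentLaw M (y + 1)) ^ 2 / (tentLaw M y + tentLaw M (y + 1)) ≤
      2 / tentMass M := by
  have hZ := tentMass_pos hM
  have h0 := tent_nonneg M y
  have h1 := tent_nonneg M (y + 1)
  have h2 : (tent M y - tent M (y + 1)) ^ 2 ≤ 1 := by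
    have := abs_tent_sub_tent_succ_le M y
    rw [← sq_abs]
    exact pow_le_one₀ (abs_nonneg _) this
  unfold tentLaw
  generalize tent M y = s at *
  generalize tent M (y + 1) = t at *
  generalize tentMass M = Z at *
  have e : (s ^ 2 / Z - t ^ 2 / Z) ^ 2 / (s ^ 2 / Z + t ^ 2 / Z) =
      ((s - t) ^ 2 * (s + t) ^ 2 / (s ^ 2 + t ^ 2)) / Z := by
    rw [← sub_div, ← add_div]
    by_cases hst : s ^ 2 + t ^ 2 = 0
    · simp [hst]
    · field_simp
      ring
  rw [e]
  refine div_le_div_of_nonneg_right ?_ hZ.le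
  refine div_le_of_le_mul₀ (by positivity) (by norm_num) ?_
  nlinarith [mul_le_mul_of_nonneg_right h2 (sq_nonneg (s + t)), sq_nonneg (s - t)]

lemma leCam_tentLaw_shift_le {M H : ℕ} (hM : 0 < M) (hHM : H ≤ M) (n : ℕ) :
    ∑ y : Signal M H, (tentLaw M ((y : ℤ) + n) - tentLaw M ((y : ℤ) + n + 1)) ^ 2 /
      (tentLaw M ((y : ℤ) + n) + tentLaw M ((y : ℤ) + n + 1)) ≤ 24 / (M : ℝ) ^ 2 := by
  have hZ := tentMass_pos hM
  have hM' : (1 : ℝ) ≤ M := by exact_mod_cast hM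
  have hcard : (Fintype.card (Signal M H) : ℝ) ≤ 4 * M := by
    rw [Fintype.card_coe, Int.card_Icc]
    have : ((M : ℤ) + 1 - -((M : ℤ) + H)).toNat ≤ 4 * M := by omega
    exact_mod_cast this
  calc _ ≤ ∑ _y : Signal M H, 2 / tentMass M :=
        Finset.sum_le_sum fun y _ => tentLaw_shift_le hM _
    _ = Fintype.card (Signal M H) * (2 / tentMass M) := by
        rw [Finset.sum_const, nsmul_eq_mul, Finset.card_univ]
    _ ≤ 4 * M * (2 / ((M : ℝ) ^ 3 / 3)) := by
        gcongr
        exact pow_three_le_tentMass M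
    _ = 24 / (M : ℝ) ^ 2 := by
        field_simp
        norm_num

/-! ### Dynamics that ignore the actions -/

/-- The dynamics that draw every next state uniformly at random. -/
noncomputable def uniformDynamics (𝒮 𝒜 : Type) [Fintype 𝒮] [Nonempty 𝒮] (H : ℕ) :
    Dynamics 𝒮 𝒜 H :=
  fun _ _ _ => ⟨fun _ => (Fintype.card 𝒮 : ℝ)⁻¹, fun _ => by positivity, by simp⟩

/-- The law of the state in step `h` under the uniform dynamics. -/
noncomputable def stateLaw {𝒮 : Type} [Fintype 𝒮] [DecidableEq 𝒮] {H : ℕ} (s₀ : 𝒮) (h : Fin H)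
    (s : 𝒮) : ℝ :=
  if (h : ℕ) = 0 then if s = s₀ then 1 else 0 else (Fintype.card 𝒮 : ℝ)⁻¹

section Trajectories

variable {𝒮 𝒜 : Type} [Fintype 𝒮] [DecidableEq 𝒮] {H : ℕ}

lemma stateLaw_nonneg (s₀ : 𝒮) (h : Fin H) (s : 𝒮) : 0 ≤ stateLaw s₀ h s := by
  unfold stateLaw
  split_ifs <;> positivity

lemma sum_stateLaw (s₀ : 𝒮) (h : Fin H) : ∑ s, stateLaw s₀ h s = 1 := by
  have : Nonempty 𝒮 := ⟨s₀⟩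
  unfold stateLaw
  split_ifs <;> simp

variable [Fintype 𝒜]

lemma policy_nonneg (π : Policy 𝒮 𝒜 H) (h : Fin H) (s : 𝒮) (a : 𝒜) : 0 ≤ (π h s).1 a :=
  (π h s).2.1 a

lemma sum_policy (π : Policy 𝒮 𝒜 H) (h : Fin H) (s : 𝒮) : ∑ a, (π h s).1 a = 1 :=
  (π h s).2.2

lemma policy_le_one (π : Policy 𝒮 𝒜 H) (h : Fin H) (s : 𝒮) (a : 𝒜) : (π h s).1 a ≤ 1 :=
  (sum_policy π h s) ▸
    Finset.single_le_sum (fun b _ => policy_nonneg π h s b) (Finset.mem_univ a)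

lemma arrivalProb_nonneg (p : Dynamics 𝒮 𝒜 H) (s₀ : 𝒮) (τ : Trajectory 𝒮 𝒜 H) (h : Fin H) :
    0 ≤ arrivalProb p s₀ τ h := by
  obtain ⟨n, hn⟩ := h
  cases n with
  | zero => simp only [arrivalProb]; split_ifs <;> norm_num
  | succ n => exact (p _ _ _).2.1 _

lemma arrivalProb_le_one (p : Dynamics 𝒮 𝒜 H) (s₀ : 𝒮) (τ : Trajectory 𝒮 𝒜 H) (h : Fin H) :
    arrivalProb p s₀ τ h ≤ 1 := by
  obtain ⟨n, hn⟩ := h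
  cases n with
  | zero => simp only [arrivalProb]; split_ifs <;> norm_num
  | succ n =>
    have q := (p ⟨n, Nat.lt_of_succ_lt hn⟩ (τ ⟨n, Nat.lt_of_succ_lt hn⟩).1
      (τ ⟨n, Nat.lt_of_succ_lt hn⟩).2).2
    exact q.2 ▸ Finset.single_le_sum (fun b _ => q.1 b) (Finset.mem_univ _)

lemma trajectoryProb_nonneg (p : Dynamics 𝒮 𝒜 H) (s₀ : 𝒮) (π : Policy 𝒮 𝒜 H)
    (τ : Trajectory 𝒮 𝒜 H) : 0 ≤ trajectoryProb p s₀ π τ :=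
  Finset.prod_nonneg fun _ _ => mul_nonneg (arrivalProb_nonneg _ _ _ _) (policy_nonneg _ _ _ _)

lemma trajectoryProb_le_one (p : Dynamics 𝒮 𝒜 H) (s₀ : 𝒮) (π : Policy 𝒮 𝒜 H)
    (τ : Trajectory 𝒮 𝒜 H) : trajectoryProb p s₀ π τ ≤ 1 :=
  Finset.prod_le_one
    (fun _ _ => mul_nonneg (arrivalProb_nonneg _ _ _ _) (policy_nonneg _ _ _ _))
    fun _ _ => mul_le_one₀ (arrivalProb_le_one _ _ _ _) (policy_nonneg _ _ _ _)
      (policy_le_one _ _ _ _)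

lemma trajectoryProb_uniformDynamics [Nonempty 𝒮] (s₀ : 𝒮) (π : Policy 𝒮 𝒜 H)
    (τ : Trajectory 𝒮 𝒜 H) :
    trajectoryProb (uniformDynamics 𝒮 𝒜 H) s₀ π τ =
      ∏ h, stateLaw s₀ h (τ h).1 * (π h (τ h).1).1 (τ h).2 := by
  refine Finset.prod_congr rfl fun h _ => ?_
  congr 1
  obtain ⟨n, hn⟩ := h
  cases n with
  | zero => simp [arrivalProb, stateLaw]
  | succ n => simp [arrivalProb, stateLaw, uniformDynamics]

lemma sum_prod_mul_apply {ι X : Type*} [Fintype ι] [DecidableEq ι] [Fintype X] {ν : ι → X → ℝ}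
    (hν : ∀ i, ∑ x, ν i x = 1) (i : ι) (f : X → ℝ) :
    ∑ τ : ι → X, (∏ j, ν j (τ j)) * f (τ i) = ∑ x, ν i x * f x := by
  have h1 : ∀ τ : ι → X, (∏ j, ν j (τ j)) * f (τ i) =
      ∏ j, ν j (τ j) * (if j = i then f (τ j) else 1) := fun τ => by
    rw [Finset.prod_mul_distrib, Finset.prod_ite_eq' Finset.univ i fun j => f (τ j)]
    simp
  simp only [h1]
  have h2 := Finset.prod_univ_sum (fun _ : ι => (Finset.univ : Finset X))
    fun j x => ν j x * (if j = i then f x else 1)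
  rw [Fintype.piFinset_univ] at h2
  rw [← h2, Finset.prod_eq_single i]
  · simp
  · intro j _ hj
    simp [hj, hν]
  · simp

/-- Under the uniform dynamics the state-action pairs of different steps are independent. -/
lemma sum_trajectoryProb_mul_apply [Nonempty 𝒮] (s₀ : 𝒮) (π : Policy 𝒮 𝒜 H) (h : Fin H)
    (f : 𝒮 × 𝒜 → ℝ) :
    ∑ τ, trajectoryProb (uniformDynamics 𝒮 𝒜 H) s₀ π τ * f (τ h) =
      ∑ s, stateLaw s₀ h s * ∑ a, (π h s).1 a * f (s, a) := by
  simp only [trajectoryProb_uniformDynamics]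
  rw [sum_prod_mul_apply (ν := fun j (x : 𝒮 × 𝒜) => stateLaw s₀ j x.1 * (π j x.1).1 x.2),
    Fintype.sum_prod_type]
  · simp only [Finset.mul_sum, mul_assoc]
  · intro j
    rw [Fintype.sum_prod_type]
    simp only [← Finset.mul_sum, sum_policy, mul_one]
    exact sum_stateLaw s₀ j

lemma sum_trajectoryProb [Nonempty 𝒮] (s₀ : 𝒮) (π : Policy 𝒮 𝒜 H) :
    ∑ τ, trajectoryProb (uniformDynamics 𝒮 𝒜 H) s₀ π τ = 1 := by
  simp only [trajectoryProb_uniformDynamics]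
  have h2 := Finset.prod_univ_sum (fun _ : Fin H => (Finset.univ : Finset (𝒮 × 𝒜)))
    fun j x => stateLaw s₀ j x.1 * (π j x.1).1 x.2
  rw [Fintype.piFinset_univ] at h2
  rw [← h2]
  refine Finset.prod_eq_one fun j _ => ?_
  rw [Fintype.sum_prod_type]
  simp only [← Finset.mul_sum, sum_policy, mul_one]
  exact sum_stateLaw s₀ j

/-! ### Costs with a hidden bonus -/

variable [DecidableEq 𝒜]

/-- The number of visits of a trajectory to the set `B` of bonus pairs. -/
def hits (B : Finset (Fin H × 𝒮 × 𝒜)) (τ : Trajectory 𝒮 𝒜 H) : ℕ :=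
  ∑ h, if (h, τ h) ∈ B then 1 else 0

lemma hits_le (B : Finset (Fin H × 𝒮 × 𝒜)) (τ : Trajectory 𝒮 𝒜 H) : hits B τ ≤ H := by
  refine (Finset.sum_le_card_nsmul _ _ 1 fun h _ => ?_).trans (by simp)
  split_ifs <;> simp

lemma hits_insert {B : Finset (Fin H × 𝒮 × 𝒜)} {h : Fin H} {x : 𝒮 × 𝒜} (hx : (h, x) ∉ B)
    (τ : Trajectory 𝒮 𝒜 H) :
    hits (insert (h, x) B) τ = hits B τ + if τ h = x then 1 else 0 := by
  have : (if τ h = x then 1 else 0 : ℕ) = ∑ j, if j = h then (if τ j = x then 1 else 0) else 0 := by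
    simp
  unfold hits
  rw [this, ← Finset.sum_add_distrib]
  refine Finset.sum_congr rfl fun j _ => ?_
  by_cases hj : j = h
  · subst hj
    by_cases hτ : τ j = x
    · simp [hτ, hx]
    · simp [hτ]
  · simp [hj]

/-- The costs with noise `g`, equal for all pairs, and a bonus `H / (4 * M)` on the pairs in `B`.
The projection to `[0, 1]` has no effect for `|g| ≤ M`, which the noise satisfies almost surely. -/
noncomputable def bonusCost (M : ℕ) (B : Finset (Fin H × 𝒮 × 𝒜)) (g : ℤ) : Cost 𝒮 𝒜 H :=
  fun h s a => Set.projIcc 0 1 zero_le_one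
    (1 / 2 + (g : ℝ) / (4 * M) - (H : ℝ) / (4 * M) * if (h, s, a) ∈ B then 1 else 0)

lemma totalCost_bonusCost {M : ℕ} (hM : 0 < M) (hHM : H ≤ M) (B : Finset (Fin H × 𝒮 × 𝒜)) {g : ℤ}
    (hg : |g| ≤ M) (τ : Trajectory 𝒮 𝒜 H) :
    totalCost (bonusCost M B g) τ = (H : ℝ) / 2 + (H : ℝ) / (4 * M) * (g - hits B τ) := by
  have hM' : (0 : ℝ) < M := by exact_mod_cast hM
  have hg' : |(g : ℝ)| ≤ M := by exact_mod_cast hg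
  have h1 : |(g : ℝ) / (4 * M)| ≤ 1 / 4 := by
    rw [abs_div, abs_of_pos (by positivity : (0 : ℝ) < 4 * M), div_le_iff₀ (by positivity)]
    linarith
  have h2 : (H : ℝ) / (4 * M) ≤ 1 / 4 := by
    rw [div_le_iff₀ (by positivity)]
    have : (H : ℝ) ≤ M := by exact_mod_cast hHM
    linarith
  have h3 : 0 ≤ (H : ℝ) / (4 * M) := by positivity
  obtain ⟨h4, h5⟩ := abs_le.1 h1
  have hc : ∀ h s a, ((bonusCost M B g h s a : Set.Icc (0 : ℝ) 1) : ℝ) =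
      1 / 2 + (g : ℝ) / (4 * M) - (H : ℝ) / (4 * M) * if (h, s, a) ∈ B then 1 else 0 := by
    intro h s a
    unfold bonusCost
    rw [Set.projIcc_of_mem]
    constructor <;> split_ifs <;> linarith
  unfold totalCost hits
  simp only [hc, Finset.sum_sub_distrib, ← Finset.mul_sum]
  push_cast
  simp only [Finset.sum_const, Finset.card_univ, Fintype.card_fin, nsmul_eq_mul]
  ring

/-- The triples of a step, a state and the action that `a` prescribes there. -/
def prescribed (a : Fin H × 𝒮 → 𝒜) : Finset (Fin H × 𝒮 × 𝒜) :=
  Finset.univ.filter fun x => x.2.2 = a (x.1, x.2.1)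

lemma prescribed_update (a : Fin H × 𝒮 → 𝒜) (h : Fin H) (s : 𝒮) (b : 𝒜) :
    prescribed (Function.update a (h, s) b) =
      insert (h, s, b) ((prescribed a).filter fun x => ¬ (x.1, x.2.1) = (h, s)) := by
  ext ⟨h', s', b'⟩
  by_cases hi : (h', s') = (h, s)
  · obtain ⟨rfl, rfl⟩ := Prod.mk.inj hi
    simp [prescribed]
  · have hi' : ¬ (h', s', b') = (h, s, b) := fun e => hi (by
      simp only [Prod.mk.injEq] at e
      rw [e.1, e.2.1])
    simp only [prescribed, Finset.mem_filter, Finset.mem_univ, true_and, Finset.mem_insert,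
      Function.update_of_ne hi, hi', false_or, hi, not_false_eq_true, and_true]

lemma sum_trajectoryProb_mul_hits [Nonempty 𝒮] (s₀ : 𝒮) (π : Policy 𝒮 𝒜 H)
    (a : Fin H × 𝒮 → 𝒜) :
    ∑ τ, trajectoryProb (uniformDynamics 𝒮 𝒜 H) s₀ π τ * (hits (prescribed a) τ : ℝ) =
      ∑ h, ∑ s, stateLaw s₀ h s * (π h s).1 (a (h, s)) := by
  unfold hits
  push_cast
  simp only [Finset.mul_sum]
  rw [Finset.sum_comm]
  refine Finset.sum_congr rfl fun h _ => ?_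
  rw [sum_trajectoryProb_mul_apply s₀ π h
    fun x => if ((h, x) : Fin H × 𝒮 × 𝒜) ∈ prescribed a then 1 else 0]
  simp [prescribed]

lemma value_bonusCost [Nonempty 𝒮] {M : ℕ} (hM : 0 < M) (hHM : H ≤ M) (s₀ : 𝒮)
    (π : Policy 𝒮 𝒜 H) (a : Fin H × 𝒮 → 𝒜) {g : ℤ} (hg : |g| ≤ M) :
    value (uniformDynamics 𝒮 𝒜 H) s₀ π (bonusCost M (prescribed a) g) =
      (H : ℝ) / 2 + (H : ℝ) / (4 * M) * g -
        (H : ℝ) / (4 * M) * ∑ h, ∑ s, stateLaw s₀ h s * (π h s).1 (a (h, s)) := by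
  rw [← sum_trajectoryProb_mul_hits, Finset.mul_sum]
  unfold value
  simp only [totalCost_bonusCost hM hHM _ hg]
  rw [← one_mul ((H : ℝ) / 2 + (H : ℝ) / (4 * M) * g), ← sum_trajectoryProb s₀ π, Finset.sum_mul,
    ← Finset.sum_sub_distrib]
  exact Finset.sum_congr rfl fun τ _ => by ring

lemma totalCost_nonneg (l : Cost 𝒮 𝒜 H) (τ : Trajectory 𝒮 𝒜 H) : 0 ≤ totalCost l τ :=
  Finset.sum_nonneg fun h _ => (l h (τ h).1 (τ h).2).2.1

lemma value_nonneg (p : Dynamics 𝒮 𝒜 H) (s₀ : 𝒮) (π : Policy 𝒮 𝒜 H) (l : Cost 𝒮 𝒜 H) :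
    0 ≤ value p s₀ π l :=
  Finset.sum_nonneg fun τ _ => mul_nonneg (trajectoryProb_nonneg p s₀ π τ) (totalCost_nonneg l τ)

/-- The noise cancels in the regret against the policy that plays the prescribed actions. -/
lemma le_regret_bonusCost [Nonempty 𝒮] {M K : ℕ} (hM : 0 < M) (hHM : H ≤ M) (s₀ : 𝒮)
    (a : Fin H × 𝒮 → 𝒜) {g : Fin K → ℤ} (hg : ∀ k, |g k| ≤ M) (π : Fin K → Policy 𝒮 𝒜 H) :
    (H : ℝ) / (4 * M) * ∑ k, ∑ h, ∑ s, stateLaw s₀ h s * (1 - (π k h s).1 (a (h, s))) ≤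
      regret (uniformDynamics 𝒮 𝒜 H) s₀ (fun k => bonusCost M (prescribed a) (g k)) π := by
  let ρ : Policy 𝒮 𝒜 H := fun h s => ⟨Pi.single (a (h, s)) 1, single_mem_stdSimplex ℝ _⟩
  have hbdd : BddBelow (Set.range fun ρ : Policy 𝒮 𝒜 H =>
      ∑ k, value (uniformDynamics 𝒮 𝒜 H) s₀ ρ (bonusCost M (prescribed a) (g k))) :=
    ⟨0, by rintro _ ⟨ρ, rfl⟩; exact Finset.sum_nonneg fun k _ => value_nonneg _ _ _ _⟩
  have hinf := ciInf_le hbdd ρ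
  unfold regret
  refine le_trans (le_of_eq ?_) (sub_le_sub_left hinf _)
  rw [← Finset.sum_sub_distrib, Finset.mul_sum]
  refine Finset.sum_congr rfl fun k _ => ?_
  rw [value_bonusCost hM hHM s₀ _ a (hg k), value_bonusCost hM hHM s₀ _ a (hg k)]
  simp only [ρ, Pi.single_eq_same, mul_sub, Finset.sum_sub_distrib]
  ring

/-! ### The law of the learner's observations -/

/-- What the learner sees in an episode with trajectory `o.1` in which the noise minus the number
of visits to bonus pairs is `o.2`. -/
noncomputable def signal {M : ℕ} (o : Trajectory 𝒮 𝒜 H × Signal M H) : Trajectory 𝒮 𝒜 H × ℝ :=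
  (o.1, (H : ℝ) / 2 + (H : ℝ) / (4 * M) * ((o.2 : ℤ) : ℝ))

/-- The conditional law of an episode, given the earlier ones, when the learner plays `pol` and the
bonus set is `B`. -/
noncomputable def obsKernel [Nonempty 𝒮] {K : ℕ} (M : ℕ) (s₀ : 𝒮)
    (pol : (k : Fin K) → (Fin k → Trajectory 𝒮 𝒜 H × ℝ) → Policy 𝒮 𝒜 H)
    (B : Finset (Fin H × 𝒮 × 𝒜)) (k : Fin K) (past : Fin k → Trajectory 𝒮 𝒜 H × Signal M H)
    (o : Trajectory 𝒮 𝒜 H × Signal M H) : ℝ :=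
  trajectoryProb (uniformDynamics 𝒮 𝒜 H) s₀ (pol k fun j => signal (past j)) o.1 *
    tentLaw M (o.2 + hits B o.1)

section Kernel

variable [Nonempty 𝒮] {K M : ℕ} {s₀ : 𝒮}
  {pol : (k : Fin K) → (Fin k → Trajectory 𝒮 𝒜 H × ℝ) → Policy 𝒮 𝒜 H}

lemma obsKernel_nonneg (B : Finset (Fin H × 𝒮 × 𝒜)) (k : Fin K)
    (past : Fin k → Trajectory 𝒮 𝒜 H × Signal M H) (o : Trajectory 𝒮 𝒜 H × Signal M H) :
    0 ≤ obsKernel M s₀ pol B k past o :=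
  mul_nonneg (trajectoryProb_nonneg _ _ _ _) (tentLaw_nonneg _ _)

lemma sum_obsKernel (hM : 0 < M) (B : Finset (Fin H × 𝒮 × 𝒜)) (k : Fin K)
    (past : Fin k → Trajectory 𝒮 𝒜 H × Signal M H) :
    ∑ o, obsKernel M s₀ pol B k past o = 1 := by
  unfold obsKernel
  rw [Fintype.sum_prod_type]
  simp only [← Finset.mul_sum, sum_tentLaw_add hM (hits_le B _), mul_one]
  exact sum_trajectoryProb _ _

/-- One more bonus pair changes the law of an episode only if the pair is visited, and then shifts
the noise by one. -/
lemma leCam_obsKernel_insert_le (hM : 0 < M) (hHM : H ≤ M) {B : Finset (Fin H × 𝒮 × 𝒜)} {h : Fin H}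
    (hh : (h : ℕ) ≠ 0) {s : 𝒮} {b : 𝒜} (hb : (h, s, b) ∉ B) (k : Fin K)
    (past : Fin k → Trajectory 𝒮 𝒜 H × Signal M H) :
    leCam (obsKernel M s₀ pol B k past) (obsKernel M s₀ pol (insert (h, s, b) B) k past) ≤
      24 / ((M : ℝ) ^ 2 * Fintype.card 𝒮) * (pol k (fun j => signal (past j)) h s).1 b := by
  set π := pol k fun j => signal (past j) with hπ
  have hpt : ∀ τ : Trajectory 𝒮 𝒜 H, ∑ y : Signal M H,
      (obsKernel M s₀ pol B k past (τ, y) -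
          obsKernel M s₀ pol (insert (h, s, b) B) k past (τ, y)) ^ 2 /
        (obsKernel M s₀ pol B k past (τ, y) +
          obsKernel M s₀ pol (insert (h, s, b) B) k past (τ, y)) ≤
      trajectoryProb (uniformDynamics 𝒮 𝒜 H) s₀ π τ *
        (24 / (M : ℝ) ^ 2 * if τ h = (s, b) then 1 else 0) := by
    intro τ
    have hT := trajectoryProb_nonneg (uniformDynamics 𝒮 𝒜 H) s₀ π τ
    simp only [obsKernel, ← hπ, hits_insert hb]
    generalize trajectoryProb (uniformDynamics 𝒮 𝒜 H) s₀ π τ = T at *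
    split_ifs with hτ
    · have hsc : ∀ q q' : ℝ, (T * q - T * q') ^ 2 / (T * q + T * q') =
          T * ((q - q') ^ 2 / (q + q')) := by
        intro q q'
        rcases hT.eq_or_lt with rfl | hT
        · simp
        · rw [← mul_sub, ← mul_add, mul_pow, sq T, mul_assoc, mul_div_mul_left _ _ hT.ne',
            mul_div_assoc]
      simp only [hsc, ← Finset.mul_sum, mul_one]
      refine mul_le_mul_of_nonneg_left ?_ hT
      have := leCam_tentLaw_shift_le hM hHM (hits B τ)
      push_cast
      simpa only [add_assoc] using this
    · simp
  unfold leCam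
  rw [Fintype.sum_prod_type]
  refine (Finset.sum_le_sum fun τ _ => hpt τ).trans (le_of_eq ?_)
  rw [sum_trajectoryProb_mul_apply s₀ π h fun x => 24 / (M : ℝ) ^ 2 * if x = (s, b) then 1 else 0]
  simp only [stateLaw, hh, if_false, Prod.mk.injEq]
  rw [Finset.sum_eq_single s, Finset.sum_eq_single b]
  · simp only [and_self, if_true]
    rw [div_mul_eq_div_div, div_eq_mul_inv (24 / (M : ℝ) ^ 2)]
    ring
  · intro c _ hc
    simp [hc]
  · simp
  · intro t _ ht
    simp [ht]
  · simp

/-- If the bonus action in one step-state pair is drawn uniformly, then the learner plays it with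
probability at most `3 / 4` on average: with `B` as the reference bonus set, the divergences add up
to at most `24 K / (M² |𝒮|)`. -/
lemma sum_obsLaw_insert_mul_policy_le (hM : 0 < M) (hHM : H ≤ M)
    (hA : 2 ≤ Fintype.card 𝒜)
    (hKM : 3072 * (K : ℝ) ≤ (M : ℝ) ^ 2 * (Fintype.card 𝒮 * Fintype.card 𝒜))
    {B : Finset (Fin H × 𝒮 × 𝒜)} {h : Fin H} (hh : (h : ℕ) ≠ 0) {s : 𝒮}
    (hB : ∀ b, (h, s, b) ∉ B) (k : Fin K) :
    ∑ b, ∑ o, pathProb (obsKernel M s₀ pol (insert (h, s, b) B)) o *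
        (pol k (fun j => signal (o (Fin.castLE k.isLt.le j))) h s).1 b ≤
      3 / 4 * Fintype.card 𝒜 := by
  have hMr : (0 : ℝ) < M := by exact_mod_cast hM
  have hS : (0 : ℝ) < Fintype.card 𝒮 := by exact_mod_cast Fintype.card_pos
  have hA' : (2 : ℝ) ≤ Fintype.card 𝒜 := by exact_mod_cast hA
  set D : ℝ := 24 / ((M : ℝ) ^ 2 * Fintype.card 𝒮) with hD
  have hone : ∑ o, pathProb (obsKernel M s₀ pol B) o = 1 := sum_pathProb (sum_obsKernel hM B)
  have hP := pathProb_nonneg (obsKernel_nonneg (M := M) (s₀ := s₀) (pol := pol) B)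
  have hpt : ∀ b, ∑ o, pathProb (obsKernel M s₀ pol (insert (h, s, b) B)) o *
        (pol k (fun j => signal (o (Fin.castLE k.isLt.le j))) h s).1 b ≤
      ∑ o, pathProb (obsKernel M s₀ pol B) o *
        ((pol k (fun j => signal (o (Fin.castLE k.isLt.le j))) h s).1 b + 1 / 8 +
          16 * ∑ i : Fin K, D *
            (pol i (fun j => signal (o (Fin.castLE i.isLt.le j))) h s).1 b) := by
    intro b
    refine (sum_pathProb_mul_le (κ := obsKernel M s₀ pol B) (obsKernel_nonneg B)
      (obsKernel_nonneg (insert (h, s, b) B)) (sum_obsKernel hM B)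
      (sum_obsKernel hM (insert (h, s, b) B))
      (f := fun o => (pol k (fun j => signal (o (Fin.castLE k.isLt.le j))) h s).1 b)
      (fun o => policy_nonneg _ _ _ _) fun o => policy_le_one _ _ _ _).trans ?_
    simp only [mul_add, Finset.sum_add_distrib]
    rw [← Finset.sum_mul (f := pathProb (obsKernel M s₀ pol B)), hone, one_mul]
    refine add_le_add_right ?_ _
    rw [Finset.mul_sum]
    refine Finset.sum_le_sum fun o _ => ?_
    rw [mul_left_comm]
    refine mul_le_mul_of_nonneg_left (mul_le_mul_of_nonneg_left ?_ (by norm_num)) (hP o)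
    exact Finset.sum_le_sum fun i _ => leCam_obsKernel_insert_le hM hHM hh (hB b) i _
  refine (Finset.sum_le_sum fun b _ => hpt b).trans ?_
  rw [Finset.sum_comm]
  have hsum : ∀ o : Fin K → Trajectory 𝒮 𝒜 H × Signal M H, ∑ b,
      pathProb (obsKernel M s₀ pol B) o *
        ((pol k (fun j => signal (o (Fin.castLE k.isLt.le j))) h s).1 b + 1 / 8 +
          16 * ∑ i : Fin K, D *
            (pol i (fun j => signal (o (Fin.castLE i.isLt.le j))) h s).1 b) =
      pathProb (obsKernel M s₀ pol B) o * (1 + Fintype.card 𝒜 / 8 + 16 * (K * D)) := by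
    intro o
    rw [← Finset.mul_sum, Finset.sum_add_distrib, Finset.sum_add_distrib, sum_policy,
      ← Finset.mul_sum, Finset.sum_comm]
    simp only [← Finset.mul_sum, sum_policy, Finset.sum_const, Finset.card_univ, nsmul_eq_mul,
      Fintype.card_fin]
    ring
  simp only [hsum]
  rw [← Finset.sum_mul, hone, one_mul]
  have hKD : 16 * (K * D) ≤ Fintype.card 𝒜 / 8 := by
    rw [hD, mul_div_assoc', mul_div_assoc', div_le_div_iff₀ (by positivity) (by norm_num)]
    linarith
  linarith

lemma sum_eq_sum_update {ι X : Type*} [Fintype ι] [DecidableEq ι] [Fintype X] (i : ι)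
    (G : (ι → X) → ℝ) :
    (Fintype.card X : ℝ) * ∑ a, G a = ∑ a, ∑ x, G (Function.update a i x) := by
  -- resampling one coordinate is the involution `(a, x) ↦ (update a i x, a i)`
  have hinv : Function.Involutive fun z : (ι → X) × X => (Function.update z.1 i z.2, z.1 i) :=
    fun z => by simp
  have h := Equiv.sum_comp hinv.toPerm fun z => G z.1
  rw [Fintype.sum_prod_type, Fintype.sum_prod_type] at h
  simp only [Function.Involutive.coe_toPerm, Finset.sum_const, Finset.card_univ,
    nsmul_eq_mul] at h
  rw [h, Finset.mul_sum]

lemma sum_obsLaw_prescribed_mul_policy_le (hM : 0 < M) (hHM : H ≤ M)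
    (hA : 2 ≤ Fintype.card 𝒜)
    (hKM : 3072 * (K : ℝ) ≤ (M : ℝ) ^ 2 * (Fintype.card 𝒮 * Fintype.card 𝒜))
    {h : Fin H} (hh : (h : ℕ) ≠ 0) (s : 𝒮) (k : Fin K) :
    ∑ a : Fin H × 𝒮 → 𝒜, ∑ o, pathProb (obsKernel M s₀ pol (prescribed a)) o *
        (pol k (fun j => signal (o (Fin.castLE k.isLt.le j))) h s).1 (a (h, s)) ≤
      3 / 4 * Fintype.card (Fin H × 𝒮 → 𝒜) := by
  have hA' : (0 : ℝ) < Fintype.card 𝒜 := by exact_mod_cast (by omega : 0 < Fintype.card 𝒜)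
  refine le_of_mul_le_mul_left ?_ hA'
  rw [sum_eq_sum_update (h, s)]
  simp only [prescribed_update, Function.update_self]
  refine (Finset.sum_le_sum fun a _ => sum_obsLaw_insert_mul_policy_le hM hHM hA hKM hh
    (fun b => by simp) k).trans (le_of_eq ?_)
  rw [Finset.sum_const, Finset.card_univ, nsmul_eq_mul]
  ring

lemma sum_stateLaw_mul_quarter (hH : 0 < H) (s₀ : 𝒮) (N : ℝ) :
    ∑ h : Fin H, ∑ s, stateLaw s₀ h s * (if (h : ℕ) = 0 then 0 else N) = ((H : ℝ) - 1) * N := by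
  obtain ⟨n, rfl⟩ := Nat.exists_eq_succ_of_ne_zero hH.ne'
  simp only [← Finset.sum_mul, sum_stateLaw, one_mul]
  rw [Fin.sum_univ_succ]
  simp

/-- The average over the prescribed actions of the expected number of steps in which the learner
deviates from them. -/
lemma le_sum_obsLaw_prescribed_mul_gap (hH : 0 < H) (hM : 0 < M) (hHM : H ≤ M)
    (hA : 2 ≤ Fintype.card 𝒜)
    (hKM : 3072 * (K : ℝ) ≤ (M : ℝ) ^ 2 * (Fintype.card 𝒮 * Fintype.card 𝒜)) :
    (Fintype.card (Fin H × 𝒮 → 𝒜) : ℝ) * (K * ((H : ℝ) - 1) / 4) ≤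
      ∑ a : Fin H × 𝒮 → 𝒜, ∑ o, pathProb (obsKernel M s₀ pol (prescribed a)) o *
        ∑ k, ∑ h, ∑ s, stateLaw s₀ h s *
          (1 - (pol k (fun j => signal (o (Fin.castLE k.isLt.le j))) h s).1 (a (h, s))) := by
  have hswap : ∑ a : Fin H × 𝒮 → 𝒜, ∑ o, pathProb (obsKernel M s₀ pol (prescribed a)) o *
        ∑ k, ∑ h, ∑ s, stateLaw s₀ h s *
          (1 - (pol k (fun j => signal (o (Fin.castLE k.isLt.le j))) h s).1 (a (h, s))) =
      ∑ k, ∑ h, ∑ s, stateLaw s₀ h s * ∑ a : Fin H × 𝒮 → 𝒜, ∑ o,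
        pathProb (obsKernel M s₀ pol (prescribed a)) o *
          (1 - (pol k (fun j => signal (o (Fin.castLE k.isLt.le j))) h s).1 (a (h, s))) := by
    trans ∑ a : Fin H × 𝒮 → 𝒜, ∑ k, ∑ h, ∑ s, stateLaw s₀ h s * ∑ o,
        pathProb (obsKernel M s₀ pol (prescribed a)) o *
          (1 - (pol k (fun j => signal (o (Fin.castLE k.isLt.le j))) h s).1 (a (h, s)))
    · refine Finset.sum_congr rfl fun a _ => ?_
      simp only [Finset.mul_sum]
      rw [Finset.sum_comm]
      refine Finset.sum_congr rfl fun k _ => ?_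
      rw [Finset.sum_comm]
      refine Finset.sum_congr rfl fun h _ => ?_
      rw [Finset.sum_comm]
      exact Finset.sum_congr rfl fun s _ => Finset.sum_congr rfl fun o _ => mul_left_comm _ _ _
    · rw [Finset.sum_comm]
      refine Finset.sum_congr rfl fun k _ => ?_
      rw [Finset.sum_comm]
      refine Finset.sum_congr rfl fun h _ => ?_
      rw [Finset.sum_comm]
      exact Finset.sum_congr rfl fun s _ => (Finset.mul_sum _ _ _).symm
  rw [hswap]
  have hterm : ∀ (k : Fin K) (h : Fin H) (s : 𝒮),
      (if (h : ℕ) = 0 then 0 else (Fintype.card (Fin H × 𝒮 → 𝒜) : ℝ) / 4) ≤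
      ∑ a : Fin H × 𝒮 → 𝒜, ∑ o, pathProb (obsKernel M s₀ pol (prescribed a)) o *
          (1 - (pol k (fun j => signal (o (Fin.castLE k.isLt.le j))) h s).1 (a (h, s))) := by
    intro k h s
    split_ifs with hh
    · exact Finset.sum_nonneg fun a _ => Finset.sum_nonneg fun o _ =>
        mul_nonneg (pathProb_nonneg (obsKernel_nonneg _) o)
          (sub_nonneg.2 (policy_le_one _ _ _ _))
    · have h1 := sum_obsLaw_prescribed_mul_policy_le (s₀ := s₀) (pol := pol) hM hHM hA hKM hh s k
      simp only [mul_sub, mul_one, Finset.sum_sub_distrib]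
      simp only [sum_pathProb (sum_obsKernel hM _), Finset.sum_const, Finset.card_univ,
        nsmul_eq_mul, mul_one]
      linarith
  have hlow := Finset.sum_le_sum fun k (_ : k ∈ (Finset.univ : Finset (Fin K))) =>
    Finset.sum_le_sum fun h (_ : h ∈ (Finset.univ : Finset (Fin H))) =>
      Finset.sum_le_sum fun s (_ : s ∈ (Finset.univ : Finset 𝒮)) =>
        mul_le_mul_of_nonneg_left (hterm k h s) (stateLaw_nonneg s₀ h s)
  refine le_trans (le_of_eq ?_) hlow
  rw [Finset.sum_const, sum_stateLaw_mul_quarter hH, Finset.card_univ, Fintype.card_fin,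
    nsmul_eq_mul]
  ring

end Kernel

end Trajectories

/-! ### Averaging over the noise and over the seed -/

/-- The change of variables from the noise `g` to `g - n`, written over the finite set of values
that `g - n` can take. -/
lemma sum_prod_tentLaw_shift {M H K : ℕ} {n : Fin K → ℕ} (hn : ∀ k, n k ≤ H)
    (Ψ : (Fin K → ℤ) → ℝ) :
    ∑ g : Fin K → Signal M H, (∏ k, tentLaw M (g k)) * Ψ (fun k => (g k : ℤ) - n k) =
      ∑ y : Fin K → Signal M H, (∏ k, tentLaw M ((y k : ℤ) + n k)) * Ψ fun k => y k := by
  have hinj : Function.Injective fun (y : Fin K → Signal M H) (k : Fin K) => ((y k : ℤ)) :=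
    fun y z h => funext fun k => Subtype.ext (congrFun h k)
  have hsupp : ∀ m : Fin K → ℕ, (∀ k, m k ≤ H) → ∀ Θ : (Fin K → ℤ) → ℝ,
      ∑ y : Fin K → Signal M H, (∏ k, tentLaw M ((y k : ℤ) + m k)) * Θ (fun k => y k) =
        ∑' z : Fin K → ℤ, (∏ k, tentLaw M (z k + m k)) * Θ z := by
    intro m hm Θ
    rw [← hinj.tsum_eq (f := fun z : Fin K → ℤ => (∏ k, tentLaw M (z k + m k)) * Θ z),
      tsum_fintype]
    intro z hz
    have hz' : ∀ k, tentLaw M (z k + m k) ≠ 0 := fun k h =>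
      hz (mul_eq_zero_of_left (Finset.prod_eq_zero (Finset.mem_univ k) h) _)
    have hmem : ∀ k, z k ∈ Finset.Icc (-((M : ℤ) + H)) M := fun k => by
      have h1 : |z k + m k| < M := not_le.1 fun h => hz' k (tentLaw_eq_zero h)
      have h2 := hm k
      rw [abs_lt] at h1
      rw [Finset.mem_Icc]
      omega
    exact ⟨fun k => ⟨z k, hmem k⟩, rfl⟩
  have h0 := hsupp (fun _ => 0) (fun _ => Nat.zero_le _) fun z => Ψ fun k => z k - n k
  simp only [Nat.cast_zero, add_zero] at h0
  rw [h0, hsupp n hn Ψ,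
    ← (Equiv.addRight fun k => (n k : ℤ)).tsum_eq fun z : Fin K → ℤ =>
      (∏ k, tentLaw M (z k)) * Ψ fun k => z k - n k]
  simp

section Learner

variable {𝒮 𝒜 : Type} [Fintype 𝒮] [DecidableEq 𝒮] [Nonempty 𝒮] [Fintype 𝒜] [DecidableEq 𝒜]
  {H K M : ℕ}

/-- The noise enters the feedback only through its difference with the number of visits to bonus
pairs, so that summing over it gives the law `pathProb (obsKernel …)` of the observations. -/
lemma sum_noise_interactionProb_mul (hM : 0 < M) (hHM : H ≤ M) (L : Learner.{u} 𝒮 𝒜 H K) (s₀ : 𝒮)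
    (B : Finset (Fin H × 𝒮 × 𝒜)) (ω : L.Seed) (F : (Fin K → Policy 𝒮 𝒜 H) → ℝ) :
    ∑ g : Fin K → Signal M H, (∏ k, tentLaw M (g k)) *
        ∑ τ, interactionProb L (uniformDynamics 𝒮 𝒜 H) s₀ (fun k => bonusCost M B (g k)) ω τ *
          F (L.played (fun k => bonusCost M B (g k)) ω τ) =
      ∑ o, pathProb (obsKernel M s₀ (fun k past => L.policy k ω past) B) o *
        F fun k => L.policy k ω fun j => signal (o (Fin.castLE k.isLt.le j)) := by
  -- policies as functions of the trajectories and of the noise minus the number of visits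
  let pl : (Fin K → Trajectory 𝒮 𝒜 H) → (Fin K → ℤ) → Fin K → Policy 𝒮 𝒜 H := fun τ z k =>
    L.policy k ω fun j => (τ (Fin.castLE k.isLt.le j),
      (H : ℝ) / 2 + (H : ℝ) / (4 * M) * (z (Fin.castLE k.isLt.le j) : ℝ))
  let Ψ : (Fin K → Trajectory 𝒮 𝒜 H) → (Fin K → ℤ) → ℝ := fun τ z =>
    (∏ k, trajectoryProb (uniformDynamics 𝒮 𝒜 H) s₀ (pl τ z k) (τ k)) * F (pl τ z)
  have hleft : ∀ (g : Fin K → Signal M H) (τ : Fin K → Trajectory 𝒮 𝒜 H),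
      (∏ k, tentLaw M (g k)) *
        (interactionProb L (uniformDynamics 𝒮 𝒜 H) s₀ (fun k => bonusCost M B (g k)) ω τ *
          F (L.played (fun k => bonusCost M B (g k)) ω τ)) =
      (∏ k, tentLaw M (g k)) * Ψ τ fun k => (g k : ℤ) - hits B (τ k) := by
    intro g τ
    by_cases hg : ∃ k, (M : ℤ) < |(g k : ℤ)|
    · obtain ⟨k, hk⟩ := hg
      rw [Finset.prod_eq_zero (Finset.mem_univ k) (tentLaw_eq_zero hk.le), zero_mul, zero_mul]
    · push Not at hg
      have hpl : L.played (fun k => bonusCost M B (g k)) ω τ =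
          pl τ fun k => (g k : ℤ) - hits B (τ k) := by
        funext k
        simp only [Learner.played, pl]
        congr 1
        funext j
        simp only [feedback, totalCost_bonusCost hM hHM B (hg _)]
        push_cast
        rfl
      simp only [interactionProb, hpl, Ψ]
  simp only [Finset.mul_sum, hleft]
  rw [Finset.sum_comm]
  rw [← Equiv.sum_comp (Equiv.arrowProdEquivProdArrow (Fin K) (fun _ => Trajectory 𝒮 𝒜 H)
    fun _ => Signal M H).symm, Fintype.sum_prod_type]
  refine Finset.sum_congr rfl fun τ _ => ?_
  rw [sum_prod_tentLaw_shift (fun k => hits_le B (τ k)) (Ψ τ)]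
  refine Finset.sum_congr rfl fun y _ => ?_
  simp only [pathProb, obsKernel, Finset.prod_mul_distrib, Ψ]
  rw [← mul_assoc, mul_comm (∏ k, tentLaw M _)]
  rfl

lemma measurable_played (L : Learner.{u} 𝒮 𝒜 H K) (l : Fin K → Cost 𝒮 𝒜 H)
    (τ : Fin K → Trajectory 𝒮 𝒜 H) (k : Fin K) (h : Fin H) (s : 𝒮) (a : 𝒜) :
    Measurable fun ω => (L.played l ω τ k h s).1 a :=
  (measurable_pi_apply a).comp <| measurable_subtype_coe.comp <| (measurable_pi_apply s).comp <|
    (measurable_pi_apply h).comp <| L.measurable_policy k _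

lemma measurable_trajectoryProb_played (L : Learner.{u} 𝒮 𝒜 H K) (p : Dynamics 𝒮 𝒜 H) (s₀ : 𝒮)
    (l : Fin K → Cost 𝒮 𝒜 H) (τ : Fin K → Trajectory 𝒮 𝒜 H) (k : Fin K)
    (σ : Trajectory 𝒮 𝒜 H) :
    Measurable fun ω => trajectoryProb p s₀ (L.played l ω τ k) σ :=
  Finset.measurable_fun_prod _ fun h _ => (measurable_played L l τ k h _ _).const_mul _

lemma integrable_interactionProb_mul_regret (L : Learner.{u} 𝒮 𝒜 H K) (p : Dynamics 𝒮 𝒜 H)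
    (s₀ : 𝒮) (l : Fin K → Cost 𝒮 𝒜 H) :
    Integrable (fun ω => ∑ τ : Fin K → Trajectory 𝒮 𝒜 H,
      interactionProb L p s₀ l ω τ * regret p s₀ l (L.played l ω τ)) L.law := by
  have hprob : ∀ τ k σ, Integrable (fun ω => trajectoryProb p s₀ (L.played l ω τ k) σ) L.law :=
    fun τ k σ => Integrable.of_bound
      (measurable_trajectoryProb_played L p s₀ l τ k σ).aestronglyMeasurable 1
      (ae_of_all _ fun ω => by
        rw [Real.norm_of_nonneg (trajectoryProb_nonneg _ _ _ _)]
        exact trajectoryProb_le_one _ _ _ _)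
  refine integrable_finsetSum _ fun τ _ => ?_
  refine Integrable.bdd_mul (c := 1) ?_ ?_ ?_
  · unfold regret value
    refine Integrable.sub ?_ (integrable_const _)
    exact integrable_finsetSum _ fun k _ => integrable_finsetSum _ fun σ _ =>
      (hprob τ k σ).mul_const _
  · exact (Finset.measurable_fun_prod _ fun k _ =>
      measurable_trajectoryProb_played L p s₀ l τ k (τ k)).aestronglyMeasurable
  · refine ae_of_all _ fun ω => ?_
    unfold interactionProb
    rw [Real.norm_of_nonneg (Finset.prod_nonneg fun k _ => trajectoryProb_nonneg _ _ _ _)]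
    exact Finset.prod_le_one (fun k _ => trajectoryProb_nonneg _ _ _ _)
      fun k _ => trajectoryProb_le_one _ _ _ _

lemma sum_prod_tentLaw (hM : 0 < M) :
    ∑ g : Fin K → Signal M H, ∏ k, tentLaw M (g k) = 1 :=
  sum_pathProb (κ := fun _ _ (y : Signal M H) => tentLaw M y) fun _ _ => by
    simpa using sum_tentLaw_add (H := H) hM (Nat.zero_le H)

/-- The oblivious costs are obtained from the random instance: its average regret is large for every
value of the seed, hence after integration, and the maximum is at least the average. -/
lemma exists_le_expectedRegret_uniformDynamics (hH : 0 < H) (hM : 0 < M) (hHM : H ≤ M)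
    (hA : 2 ≤ Fintype.card 𝒜)
    (hKM : 3072 * (K : ℝ) ≤ (M : ℝ) ^ 2 * (Fintype.card 𝒮 * Fintype.card 𝒜))
    (L : Learner.{u} 𝒮 𝒜 H K) (s₀ : 𝒮) :
    ∃ l, (H : ℝ) / (4 * M) * (K * ((H : ℝ) - 1) / 4) ≤
      expectedRegret L (uniformDynamics 𝒮 𝒜 H) s₀ l := by
  have : Nonempty 𝒜 := Fintype.card_pos_iff.1 (by omega)
  set b : ℝ := (H : ℝ) / (4 * M) * (K * ((H : ℝ) - 1) / 4) with hb
  set N : ℝ := (Fintype.card (Fin H × 𝒮 → 𝒜) : ℝ) with hN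
  have hNpos : 0 < N := by rw [hN]; exact_mod_cast Fintype.card_pos
  let l : (Fin H × 𝒮 → 𝒜) → (Fin K → Signal M H) → Fin K → Cost 𝒮 𝒜 H :=
    fun a g k => bonusCost M (prescribed a) (g k)
  let R : (Fin H × 𝒮 → 𝒜) → (Fin K → Signal M H) → L.Seed → ℝ := fun a g ω =>
    ∑ τ, interactionProb L (uniformDynamics 𝒮 𝒜 H) s₀ (l a g) ω τ *
      regret (uniformDynamics 𝒮 𝒜 H) s₀ (l a g) (L.played (l a g) ω τ)
  have hprod : ∀ g : Fin K → Signal M H, 0 ≤ ∏ k, tentLaw M (g k) := fun g =>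
    Finset.prod_nonneg fun k _ => tentLaw_nonneg _ _
  have hpt : ∀ ω, N * b ≤ ∑ a, ∑ g : Fin K → Signal M H, (∏ k, tentLaw M (g k)) * R a g ω := by
    intro ω
    have h1 := mul_le_mul_of_nonneg_left (le_sum_obsLaw_prescribed_mul_gap (s₀ := s₀)
      (pol := fun k past => L.policy k ω past) hH hM hHM hA hKM)
      (by positivity : 0 ≤ (H : ℝ) / (4 * M))
    rw [hN, hb, mul_left_comm]
    refine h1.trans ?_
    rw [Finset.mul_sum]
    refine Finset.sum_le_sum fun a _ => ?_
    rw [← sum_noise_interactionProb_mul hM hHM L s₀ (prescribed a) ω fun π =>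
      ∑ k, ∑ h, ∑ s, stateLaw s₀ h s * (1 - (π k h s).1 (a (h, s))), Finset.mul_sum]
    refine Finset.sum_le_sum fun g _ => ?_
    rw [mul_left_comm]
    by_cases hg : ∃ k, (M : ℤ) < |(g k : ℤ)|
    · obtain ⟨k, hk⟩ := hg
      rw [Finset.prod_eq_zero (Finset.mem_univ k) (tentLaw_eq_zero hk.le), zero_mul, zero_mul]
    · push Not at hg
      refine mul_le_mul_of_nonneg_left ?_ (hprod g)
      rw [Finset.mul_sum]
      refine Finset.sum_le_sum fun τ _ => ?_
      rw [mul_left_comm]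
      exact mul_le_mul_of_nonneg_left (le_regret_bonusCost hM hHM s₀ a hg _)
        (Finset.prod_nonneg fun k _ => trajectoryProb_nonneg _ _ _ _)
  have hint : ∀ a g, Integrable (fun ω => (∏ k, tentLaw M (g k)) * R a g ω) L.law := fun a g =>
    (integrable_interactionProb_mul_regret L _ s₀ (l a g)).const_mul _
  have hmean : N * b ≤ ∑ a, ∑ g : Fin K → Signal M H, (∏ k, tentLaw M (g k)) *
      expectedRegret L (uniformDynamics 𝒮 𝒜 H) s₀ (l a g) := by
    have h1 := integral_mono (integrable_const (N * b))
      (integrable_finsetSum Finset.univ fun a _ => integrable_finsetSum Finset.univ fun g _ =>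
        hint a g) hpt
    rw [integral_const, probReal_univ, one_smul, integral_finsetSum _ fun a _ =>
      integrable_finsetSum Finset.univ fun g _ => hint a g] at h1
    refine h1.trans (le_of_eq (Finset.sum_congr rfl fun a _ => ?_))
    rw [integral_finsetSum _ fun g _ => hint a g]
    exact Finset.sum_congr rfl fun g _ => integral_const_mul _ _
  have : Nonempty (Fin K → Signal M H) := ⟨fun _ => ⟨0, by rw [Finset.mem_Icc]; omega⟩⟩
  obtain ⟨⟨a₀, g₀⟩, hmax⟩ := Finite.exists_max fun z : (Fin H × 𝒮 → 𝒜) × (Fin K → Signal M H) =>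
    expectedRegret L (uniformDynamics 𝒮 𝒜 H) s₀ (l z.1 z.2)
  have hle : N * b ≤ N * expectedRegret L (uniformDynamics 𝒮 𝒜 H) s₀ (l a₀ g₀) := by
    refine hmean.trans ((Finset.sum_le_sum fun a _ => Finset.sum_le_sum fun g _ =>
      mul_le_mul_of_nonneg_left (hmax (a, g)) (hprod g)).trans (le_of_eq ?_))
    simp only [← Finset.sum_mul, sum_prod_tentLaw hM, one_mul, Finset.sum_const, Finset.card_univ,
      nsmul_eq_mul, hN]
  exact ⟨_, le_of_mul_le_mul_left hle hNpos⟩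

end Learner

theorem theorem3 :
    ∃ c : ℝ, 0 < c ∧
      ∀ H S A K : ℕ, 2 ≤ H → 2 ≤ S → 2 ≤ A → 2 * S ≤ K →
        -- the algorithm is given the dynamics and the initial state
        ∀ alg : Dynamics (Fin S) (Fin A) H → Fin S → Learner.{u} (Fin S) (Fin A) H K,
          ∃ (p : Dynamics (Fin S) (Fin A) H) (s₀ : Fin S)
            (l : Fin K → Cost (Fin S) (Fin A) H),
            c * min ((H : ℝ) ^ 2 * √((S : ℝ) * A * K)) ((H : ℝ) * K) ≤
              expectedRegret (alg p s₀) p s₀ l := by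
  refine ⟨1 / 8192, by norm_num, fun H S A K hH hS hA hK alg => ?_⟩
  have : Nonempty (Fin S) := ⟨⟨0, by omega⟩⟩
  have hH' : (2 : ℝ) ≤ H := by exact_mod_cast hH
  have hS' : (2 : ℝ) ≤ S := by exact_mod_cast hS
  have hA' : (2 : ℝ) ≤ A := by exact_mod_cast hA
  have hK' : (0 : ℝ) < K := by exact_mod_cast (by omega : 0 < K)
  set n : ℝ := (S : ℝ) * A with hn
  have hnpos : 0 < n := by positivity
  set x : ℝ := √((K : ℝ) / n) with hx
  have hx0 : 0 ≤ x := Real.sqrt_nonneg _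
  have hxx : x ^ 2 * n = K := by
    rw [hx, Real.sq_sqrt (by positivity)]
    field_simp
  -- the smallest half-width allowed by `H ≤ M` and `hKM`, up to a constant factor
  set M : ℕ := H + ⌈64 * x⌉₊ with hMdef
  have hMlow : 64 * x ≤ M := by
    rw [hMdef]
    push_cast
    linarith [Nat.le_ceil (64 * x)]
  have hMup : (M : ℝ) ≤ 2 * H + 64 * x := by
    rw [hMdef]
    push_cast
    linarith [Nat.ceil_lt_add_one (by positivity : 0 ≤ 64 * x)]
  have hMpos : 0 < M := by omega
  have hMpos' : (0 : ℝ) < M := by exact_mod_cast hMpos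
  have hKM : 3072 * (K : ℝ) ≤ (M : ℝ) ^ 2 * n := by
    have : (64 * x) ^ 2 ≤ (M : ℝ) ^ 2 := pow_le_pow_left₀ (by positivity) hMlow 2
    nlinarith [mul_le_mul_of_nonneg_right this hnpos.le]
  obtain ⟨l, hl⟩ := exists_le_expectedRegret_uniformDynamics (𝒮 := Fin S) (𝒜 := Fin A) (K := K)
    (by omega : 0 < H) hMpos (by omega : H ≤ M) (by simpa using hA) (by simpa using hKM)
    (alg (uniformDynamics (Fin S) (Fin A) H) ⟨0, by omega⟩) ⟨0, by omega⟩
  refine ⟨_, _, l, le_trans ?_ hl⟩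
  have hsqrt : √(n * K) = n * x := by
    rw [← hxx, show n * (x ^ 2 * n) = (n * x) ^ 2 by ring, Real.sqrt_sq (by positivity)]
  rw [hsqrt]
  have h1 : (H : ℝ) ^ 2 * K / (32 * M) ≤ (H : ℝ) / (4 * M) * (K * ((H : ℝ) - 1) / 4) := by
    rw [div_mul_div_comm, div_le_div_iff₀ (by positivity) (by positivity)]
    have : 0 ≤ (H : ℝ) * K * M * (H - 2) := by
      have : (0 : ℝ) ≤ H - 2 := by linarith
      positivity
    nlinarith
  refine le_trans ?_ h1
  rw [le_div_iff₀ (by positivity)]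
  rcases le_total (H : ℝ) x with hxH | hxH
  · have hm : (M : ℝ) ≤ 66 * x := by linarith
    calc 1 / 8192 * min ((H : ℝ) ^ 2 * (n * x)) (H * K) * (32 * M)
        ≤ 1 / 8192 * ((H : ℝ) ^ 2 * (n * x)) * (32 * (66 * x)) := by
          gcongr
          exact min_le_left _ _
      _ = 2112 / 8192 * ((H : ℝ) ^ 2 * (x ^ 2 * n)) := by ring
      _ ≤ (H : ℝ) ^ 2 * K := by
          rw [hxx]
          have : 0 ≤ (H : ℝ) ^ 2 * K := by positivity
          linarith
  · have hm : (M : ℝ) ≤ 66 * H := by linarith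
    calc 1 / 8192 * min ((H : ℝ) ^ 2 * (n * x)) (H * K) * (32 * M)
        ≤ 1 / 8192 * (H * K) * (32 * (66 * H)) := by
          gcongr
          exact min_le_right _ _
      _ ≤ (H : ℝ) ^ 2 * K := by
          have : 0 ≤ (H : ℝ) ^ 2 * K := by positivity
          nlinarith
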